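/- Let $\beta$ be a quadratic Pisot unit with a negative conjugate, that is: $\beta>1$ is an algebraic integer of degree $2$, $\beta^{-1}$ is also an algebraic integer, and the other root $\beta'$ of the minimal polynomial of $\beta$ over $\mathbb{Q}$ satisfies $-1<\beta'<0$. Let $I_\beta=\left[-\frac{\beta}{\beta+1},\frac{1}{\beta+1}\right)$ and let $T:I_\beta\to I_\beta$ be the $(-\beta)$-transformation $T(x)=-\beta x-\left\lfloor -\beta x+\frac{\beta}{\beta+1}\right\rfloor$. For $x\in I_\beta$ put $d_{-\beta}(x)=x_1x_2x_3\cdots$, where $x_i=\left\lfloor -\beta T^{i-1}(x)+\frac{\beta}{\beta+1}\right\rfloor$; one says that $x$ has a purely periodic $(-\beta)$-expansion if there is an integer $N\ge 1$ with $x_{i+N}=x_i$ for all $i\ge 1$. A string of integers is called $(-\beta)$-admissible if it equals $d_{-\beta}(y)$ for some $y\in I_\beta$. Let $\mathrm{Fin}(-\beta)$ be the set consisting of $0$ and of all real numbers of the form $x=\sum_{i\ge 1}x_i(-\beta)^{n-i+1}$ with $n\in\mathbb{Z}$, $x_1\neq 0$, the string $0x_1x_2x_3\cdots$ $(-\beta)$-admissible,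 and $x_i=0$ for all sufficiently large $i$. Then: 1. every rational $x\in I_\beta\cap(-\infty,0]$ has a purely periodic $(-\beta)$-expansion; 2. no rational $x\in I_\beta\cap(0,+\infty)$ has a purely periodic $(-\beta)$-expansion; 3. the finiteness property $\mathrm{Fin}(-\beta)=\mathbb{Z}[\beta]$ fails. -/

import Mathlib

noncomputable section

namespace NegBase

/-- `γ` is an algebraic conjugate of `β`: a complex root of the minimal polynomial of `β`
over `ℚ` (`β` itself included). -/
def IsConjugate (β : ℝ) (γ : ℂ) : Prop :=
  Polynomial.aeval γ (minpoly ℚ β) = 0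

/-- A Pisot number: an algebraic integer `β > 1` all of whose other conjugates have modulus
less than one. -/
structure IsPisot (β : ℝ) : Prop where
  one_lt : 1 < β
  isIntegral : IsIntegral ℤ β
  norm_lt_one : ∀ γ : ℂ, IsConjugate β γ → γ ≠ (β : ℂ) → ‖γ‖ < 1

/-- A quadratic Pisot unit: a Pisot number of degree two whose inverse is an algebraic
integer as well. -/
structure IsQuadraticPisotUnit (β : ℝ) : Prop where
  isPisot : IsPisot β
  degree_eq_two : (minpoly ℚ β).natDegree = 2
  isIntegral_inv : IsIntegral ℤ β⁻¹

/-- `β` has a conjugate that is a negative real number. -/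
def HasNegativeConjugate (β : ℝ) : Prop :=
  ∃ γ : ℝ, γ < 0 ∧ IsConjugate β (γ : ℂ)

/-- The interval `I_β = [-β/(β+1), 1/(β+1))`. -/
def I (β : ℝ) : Set ℝ := Set.Ico (-(β / (β + 1))) (1 / (β + 1))

/-- The `(-β)`-transformation `T(x) = -βx - ⌊-βx + β/(β+1)⌋`. -/
def T (β x : ℝ) : ℝ := -β * x - (⌊-β * x + β / (β + 1)⌋ : ℝ)

/-- The digit string `d_{-β}(x)`, indexed from `0`: `digits β x i` is the `(i+1)`-st digit
`⌊-β T^i(x) + β/(β+1)⌋`. It is used for `x ∈ I β`. -/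
def digits (β x : ℝ) (i : ℕ) : ℤ := ⌊-β * (T β)^[i] x + β / (β + 1)⌋

/-- The string `d_{-β}(x)` is purely periodic, `d_{-β}(x) = (a_1 ⋯ a_N)^ω` with `N ≥ 1`. -/
def HasPurelyPeriodicExpansion (β x : ℝ) : Prop :=
  ∃ N : ℕ, 0 < N ∧ ∀ i : ℕ, digits β x (i + N) = digits β x i

/-- A string of integers is `(-β)`-admissible if it is `d_{-β}(y)` for some `y ∈ I β`. -/
def Admissible (β : ℝ) (s : ℕ → ℤ) : Prop :=
  ∃ y ∈ I β, digits β y = s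

/-- The string `0 s_0 s_1 s_2 ⋯`. -/
def zeroCons (s : ℕ → ℤ) : ℕ → ℤ
  | 0 => 0
  | i + 1 => s i

/-- `x = ∑_{i ≥ 0} s_i (-β)^(n-i)` is the `(-β)`-expansion of the real number `x`:
the leading digit `s_0` is nonzero and `0 s_0 s_1 s_2 ⋯` is `(-β)`-admissible. -/
def IsExpansion (β x : ℝ) (n : ℤ) (s : ℕ → ℤ) : Prop :=
  s 0 ≠ 0 ∧ Admissible β (zeroCons s) ∧
    HasSum (fun i : ℕ => (s i : ℝ) * (-β) ^ (n - (i : ℤ))) x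

/-- `Fin(-β)`: the real numbers whose `(-β)`-expansion ends in repeating zeros; the number
`0`, which has no leading digit, belongs to it. -/
def finiteExpansions (β : ℝ) : Set ℝ :=
  {x | x = 0 ∨ ∃ (n : ℤ) (s : ℕ → ℤ), IsExpansion β x n s ∧ ∃ k : ℕ, ∀ i ≥ k, s i = 0}

/-- The finiteness property `Fin(-β) = ℤ[β]`. -/
def FinitenessProperty (β : ℝ) : Prop :=
  finiteExpansions β = (Algebra.adjoin ℤ {β} : Set ℝ)

end NegBase

end

namespace NegBase

open Polynomial

/-! The conjugate of `-β` is `β - m = 1/β`, which lies in `(0, 1)`, and all digits are nonnegative.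
So `T` acts on conjugates by `y' ↦ (β - m) y' - d` with `d ≥ 0`, and this positivity drives all
three claims. Claim 1: the pair (`T`, conjugate map) is injective on the domain `InDomain`, and
preserves it away from the left endpoint of `I β` (`InDomain.step_injective`, `InDomain.step`). Only
finitely many points of `(1/q)ℤ[β]` lie there, so each is periodic; a rational `x ≤ 0` is its own
conjugate and lies there. Claim 2: a period `N` of a rational `x > 0` would give `x ≤ x (β - m)^N <
x`. Claim 3: a finite expansion has a nonnegative conjugate, so `-1` has none. -/

/-- The setting `β² = mβ + 1` of a quadratic Pisot unit with negative conjugate `m - β`. -/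
structure QuadraticData (β : ℝ) (m : ℤ) : Prop where
  one_le : 1 ≤ m
  one_lt : 1 < β
  sq_eq : β ^ 2 = m * β + 1
  irrational : Irrational β

/-! ### Reduction to `β² = mβ + 1` -/

theorem irrational_of_natDegree_minpoly {β : ℝ} (h : (minpoly ℚ β).natDegree = 2) :
    Irrational β := by
  rintro ⟨x, rfl⟩
  have := minpoly.eq_X_sub_C ℝ x
  simp only [eq_ratCast] at this
  rw [this, natDegree_X_sub_C] at h
  omega

theorem aeval_eq_zero_of_isConjugate {β γ : ℝ} (hγ : IsConjugate β (γ : ℂ)) {p : ℚ[X]}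
    (hp : aeval β p = 0) : aeval γ p = 0 := by
  obtain ⟨g, rfl⟩ := minpoly.dvd ℚ β hp
  have h : aeval γ (minpoly ℚ β) = 0 := by
    have h1 : aeval (algebraMap ℝ ℂ γ) (minpoly ℚ β) = 0 := hγ
    rw [aeval_algebraMap_apply] at h1
    exact (algebraMap ℝ ℂ).injective (by simpa using h1)
  rw [map_mul, h, zero_mul]

theorem isIntegral_inv_of_isConjugate {β γ : ℝ} (hβ0 : β ≠ 0) (hγ0 : γ ≠ 0)
    (hγ : IsConjugate β (γ : ℂ)) (h : IsIntegral ℤ β⁻¹) : IsIntegral ℤ γ⁻¹ := by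
  obtain ⟨f, hf, hf0⟩ := h
  refine ⟨f, hf, ?_⟩
  have reverse_iff : ∀ x : ℝ, x ≠ 0 →
      (eval₂ (algebraMap ℤ ℝ) x f.reverse = 0 ↔ eval₂ (algebraMap ℤ ℝ) x⁻¹ f = 0) := by
    intro x hx
    have hu : Invertible x⁻¹ := invertibleOfNonzero (inv_ne_zero hx)
    have := eval₂_reverse_eq_zero_iff (algebraMap ℤ ℝ) x⁻¹ f
    simpa using this
  rw [← reverse_iff γ hγ0]
  have h1 := (reverse_iff β hβ0).2 hf0
  have h2 : aeval β (f.reverse.map (algebraMap ℤ ℚ)) = 0 := by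
    rw [aeval_map_algebraMap]; exact h1
  have h3 := aeval_eq_zero_of_isConjugate hγ h2
  rw [aeval_map_algebraMap] at h3
  exact h3

theorem exists_quadraticData {β : ℝ} (hβ : IsQuadraticPisotUnit β)
    (hneg : HasNegativeConjugate β) : ∃ m : ℤ, QuadraticData β m := by
  obtain ⟨γ, hγ, hconj⟩ := hneg
  have h1 := hβ.isPisot.one_lt
  have hint := hβ.isPisot.isIntegral
  have hirr := irrational_of_natDegree_minpoly hβ.degree_eq_two
  have hmin : minpoly ℚ β = (minpoly ℤ β).map (algebraMap ℤ ℚ) :=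
    minpoly.isIntegrallyClosed_eq_field_fractions' ℚ hint
  have hmonic := minpoly.monic hint
  have hdeg : (minpoly ℤ β).natDegree = 2 := by
    rw [← hβ.degree_eq_two, hmin, hmonic.natDegree_map]
  set p := (minpoly ℤ β).coeff 1
  set r := (minpoly ℤ β).coeff 0
  have hc2 : (minpoly ℤ β).coeff 2 = 1 := by
    rw [← hdeg]; exact hmonic
  have eval_eq : ∀ x : ℝ, aeval x (minpoly ℤ β) = x ^ 2 + p * x + r := by
    intro x
    rw [aeval_eq_sum_range, hdeg]
    simp [Finset.sum_range_succ, hc2, p, r]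
    ring
  have eβ : β ^ 2 + p * β + r = 0 := by rw [← eval_eq, minpoly.aeval]
  have eγ : γ ^ 2 + p * γ + r = 0 := by
    have := aeval_eq_zero_of_isConjugate hconj (minpoly.aeval ℚ β)
    rwa [hmin, aeval_map_algebraMap, eval_eq] at this
  have hsum : β + γ = -p := by
    have : (β - γ) * (β + γ + p) = 0 := by linear_combination eβ - eγ
    rcases mul_eq_zero.1 this with h | h
    · linarith
    · linarith
  have hprod : β * γ = r := by
    linear_combination β * hsum - eβ
  have hinv : IsIntegral ℤ (β⁻¹ * γ⁻¹) := hβ.isIntegral_inv.mul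
    (isIntegral_inv_of_isConjugate (by linarith) hγ.ne hconj hβ.isIntegral_inv)
  have hr0 : (r : ℝ) < 0 := by rw [← hprod]; nlinarith
  -- The inverse norm `1/r` is a rational algebraic integer, hence an integer; as `r < 0`, this
  -- forces `r = -1`.
  have hrat : β⁻¹ * γ⁻¹ = algebraMap ℚ ℝ ((r : ℚ)⁻¹) := by
    rw [← mul_inv, hprod]; simp
  rw [hrat, isIntegral_algebraMap_iff (algebraMap ℚ ℝ).injective,
    IsIntegrallyClosed.isIntegral_iff] at hinv
  obtain ⟨n, hn⟩ := hinv
  have hrZ : r < 0 := by exact_mod_cast hr0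
  have hr1 : r = -1 := by
    have h2 : (n : ℚ) * r = 1 := by
      have h3 : (n : ℚ) = (r : ℚ)⁻¹ := by simpa using hn
      rw [h3, inv_mul_cancel₀]
      exact_mod_cast hrZ.ne
    have h3 : n * r = 1 := by exact_mod_cast h2
    rcases Int.eq_one_or_neg_one_of_mul_eq_one (by linarith : r * n = 1) with h | h
    · omega
    · exact h
  have e : β ^ 2 = ((-p : ℤ) : ℝ) * β + 1 := by
    rw [hr1] at eβ; push_cast at eβ ⊢; linarith
  refine ⟨-p, ?_, h1, e, hirr⟩
  have : (0 : ℝ) < ((-p : ℤ) : ℝ) := by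
    by_contra hle
    nlinarith
  have : 0 < -p := by exact_mod_cast this
  omega

namespace QuadraticData

variable {β : ℝ} {m : ℤ}

theorem lt_self (h : QuadraticData β m) : (m : ℝ) < β := by
  have := h.one_lt; have := h.sq_eq; nlinarith

theorem self_lt (h : QuadraticData β m) : β < m + 1 := by
  have := h.one_lt; have := h.sq_eq; nlinarith

theorem eq_zero_of_add_mul_eq_zero (h : QuadraticData β m) {a b : ℤ}
    (hab : (a : ℝ) + b * β = 0) : a = 0 ∧ b = 0 := by
  have hb : b = 0 := by
    by_contra hb
    have hb' : (b : ℝ) ≠ 0 := by exact_mod_cast hb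
    refine h.irrational ⟨-a / b, ?_⟩
    push_cast
    field_simp
    linarith
  subst hb
  refine ⟨?_, rfl⟩
  simpa using hab

theorem eq_of_add_mul_eq (h : QuadraticData β m) {a b c d : ℤ}
    (he : (a : ℝ) + b * β = c + d * β) : a = c ∧ b = d := by
  have := h.eq_zero_of_add_mul_eq_zero (a := a - c) (b := b - d) (by push_cast; linarith)
  omega

end QuadraticData

/-! ### Orbits and digits in `I β` -/

section Interval

variable {β : ℝ}

theorem div_add_one_eq (h : 1 < β) : β / (β + 1) = 1 - 1 / (β + 1) := by
  field_simp; ring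

theorem mem_I_iff (h : 1 < β) {x : ℝ} :
    x ∈ I β ↔ 1 / (β + 1) - 1 ≤ x ∧ x < 1 / (β + 1) := by
  rw [I, Set.mem_Ico, div_add_one_eq h, neg_sub]

theorem T_mem_I (h : 1 < β) (x : ℝ) : T β x ∈ I β := by
  rw [mem_I_iff h, T, div_add_one_eq h]
  have h1 := Int.floor_le (-β * x + (1 - 1 / (β + 1)))
  have h2 := Int.lt_floor_add_one (-β * x + (1 - 1 / (β + 1)))
  constructor <;> linarith

theorem iterate_T_mem_I (h : 1 < β) {x : ℝ} (hx : x ∈ I β) (n : ℕ) : (T β)^[n] x ∈ I β := by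
  cases n with
  | zero => exact hx
  | succ n => rw [Function.iterate_succ_apply']; exact T_mem_I h _

/-- The offset `β/(β+1)` is `β` times the right endpoint of `I β`. -/
theorem digits_nonneg (h : 1 < β) {x : ℝ} (hx : x ∈ I β) (n : ℕ) : 0 ≤ digits β x n := by
  rw [digits, Int.floor_nonneg, div_add_one_eq h]
  have hy := ((mem_I_iff h).1 (iterate_T_mem_I h hx n)).2
  have hw : β * (1 / (β + 1)) = 1 - 1 / (β + 1) := by field_simp; ring
  nlinarith

theorem T_iterate_succ (x : ℝ) (n : ℕ) :
    (T β)^[n + 1] x = -β * (T β)^[n] x - digits β x n := by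
  rw [Function.iterate_succ_apply', T, digits]

theorem digits_iterate (x : ℝ) (N n : ℕ) :
    digits β ((T β)^[N] x) n = digits β x (n + N) := by
  rw [digits, digits, ← Function.iterate_add_apply]

/-- The digit string determines the point. -/
theorem eq_of_digits_eq (h : 1 < β) {x y : ℝ} (hx : x ∈ I β) (hy : y ∈ I β)
    (hd : ∀ n, digits β x n = digits β y n) : x = y := by
  -- Equal digits make the difference grow like `β ^ n`, while `I β` has length one.
  have hdiff : ∀ n : ℕ, (T β)^[n] x - (T β)^[n] y = (-β) ^ n * (x - y) := by
    intro n
    induction n with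
    | zero => simp
    | succ n ih =>
      rw [T_iterate_succ, T_iterate_succ, hd n, pow_succ]
      linear_combination (-β) * ih
  by_contra hne
  have hpos : 0 < |x - y| := abs_pos.2 (sub_ne_zero.2 hne)
  obtain ⟨n, hn⟩ := pow_unbounded_of_one_lt (1 / |x - y|) h
  have hxn := (mem_I_iff h).1 (iterate_T_mem_I h hx n)
  have hyn := (mem_I_iff h).1 (iterate_T_mem_I h hy n)
  have h1 : |(T β)^[n] x - (T β)^[n] y| < 1 := by rw [abs_lt]; constructor <;> linarith
  rw [hdiff, abs_mul, abs_pow, abs_neg, abs_of_pos (by linarith)] at h1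
  rw [div_lt_iff₀ hpos] at hn
  linarith

theorem exists_iterate_eq_of_hasPurelyPeriodicExpansion (h : 1 < β) {x : ℝ} (hx : x ∈ I β)
    (hp : HasPurelyPeriodicExpansion β x) : ∃ N, 0 < N ∧ (T β)^[N] x = x := by
  obtain ⟨N, hN, hper⟩ := hp
  refine ⟨N, hN, eq_of_digits_eq h (iterate_T_mem_I h hx N) hx fun n => ?_⟩
  rw [digits_iterate, hper]

theorem hasPurelyPeriodicExpansion_of_iterate_eq {x : ℝ} {N : ℕ} (hN : 0 < N)
    (hx : (T β)^[N] x = x) : HasPurelyPeriodicExpansion β x :=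
  ⟨N, hN, fun i => by rw [← digits_iterate, hx]⟩

end Interval

/-! ### Natural extension -/

/-- The domain of the natural extension of `T`, in the coordinates given by a point and its
conjugate. -/
structure InDomain (β : ℝ) (m : ℤ) (y y' : ℝ) : Prop where
  mem : y ∈ I β
  nonpos : y' ≤ 0
  left : y < 1 / (β + 1) - 1 - m + β → -(β + 1) < y'
  right : 1 / (β + 1) - 1 - m + β ≤ y → -β < y'

/-- The second coordinate of the natural extension of `T`. -/
noncomputable def conjStep (β : ℝ) (m : ℤ) (y y' : ℝ) : ℝ := y' * (β - m) - ⌊-β * y + β / (β + 1)⌋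

/-- The linear bounds on one step of the natural extension, in terms of the digit `d`, the
point `z = T y` and the conjugate `z'`. -/
theorem InDomain.step_bounds {β : ℝ} {m : ℤ} (h : QuadraticData β m) {y y' : ℝ}
    (hD : InDomain β m y y') :
    0 ≤ ⌊-β * y + β / (β + 1)⌋ ∧ conjStep β m y y' ≤ -⌊-β * y + β / (β + 1)⌋ ∧
    ((⌊-β * y + β / (β + 1)⌋ = m ∧ T β y ≤ 1 / (β + 1) - 1 - m + β ∧
        (T β y = 1 / (β + 1) - 1 - m + β → y = 1 / (β + 1) - 1) ∧
        -(β + 1) < conjStep β m y y') ∨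
      (⌊-β * y + β / (β + 1)⌋ = m - 1 ∧ 1 / (β + 1) - 1 - m + β < T β y ∧
        -β < conjStep β m y y') ∨
      (⌊-β * y + β / (β + 1)⌋ ≤ m - 1 ∧
        -1 - ⌊-β * y + β / (β + 1)⌋ < conjStep β m y y')) := by
  have h1 := h.one_lt
  have hs := h.sq_eq
  have hlt := h.lt_self
  have hlt' := h.self_lt
  have hm1 : (1 : ℝ) ≤ m := by exact_mod_cast h.one_le
  have hd0 : 0 ≤ ⌊-β * y + β / (β + 1)⌋ := digits_nonneg h1 hD.mem 0
  have hmem := (mem_I_iff h1).1 hD.mem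
  have hn := hD.nonpos
  have hl := hD.left
  have hr := hD.right
  have hw : β * (1 / (β + 1)) = 1 - 1 / (β + 1) := by field_simp; ring
  unfold conjStep T
  rw [div_add_one_eq h1] at hd0 ⊢
  generalize 1 / (β + 1) = w at *
  have f1 := Int.floor_le (-β * y + (1 - w))
  have f2 := Int.lt_floor_add_one (-β * y + (1 - w))
  generalize ⌊-β * y + (1 - w)⌋ = d at *
  have hu : y' * (β - m) ≤ 0 := mul_nonpos_of_nonpos_of_nonneg hn (by linarith)
  have hyl : 1 - w - β ≤ β * y := by nlinarith
  refine ⟨hd0, by linarith, ?_⟩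
  -- The threshold `w - 1 - m + β` is the image under `T` of the left endpoint `w - 1`, whose digit
  -- is `m`. Points below it have digit `m` or `m - 1`, the others at most `m - 1`.
  have hcmul : β * (w - 1 - m + β) = 2 - w - β := by linear_combination hw + hs
  by_cases hc : y < w - 1 - m + β
  · have hy' := hl hc
    have hu' : -1 - (β - m) < y' * (β - m) := by nlinarith
    have hby : β * y < 2 - w - β := by nlinarith
    have hdm : (m : ℝ) - 1 < d + 1 := by linarith
    have hdm' : (d : ℝ) < m + 1 := by linarith
    have hdmZ : m - 1 < d + 1 := by exact_mod_cast hdm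
    have hdmZ' : d < m + 1 := by exact_mod_cast hdm'
    rcases (by omega : d = m ∨ d = m - 1) with rfl | rfl
    · refine Or.inl ⟨rfl, by linarith, fun he => ?_, by linarith⟩
      have : β * (y - (w - 1)) = 0 := by linear_combination -he - hw
      rcases mul_eq_zero.1 this with h0 | h0 <;> linarith
    · refine Or.inr (Or.inl ⟨rfl, ?_, ?_⟩) <;> push_cast <;> linarith
  · have hy' := hr (not_lt.1 hc)
    -- Here `β (β - m) = 1`.
    have hu' : -1 < y' * (β - m) := by nlinarith
    have hby : 2 - w - β ≤ β * y := by nlinarith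
    have hdm : (d : ℝ) < m := by linarith
    have hdmZ : d < m := by exact_mod_cast hdm
    exact Or.inr (Or.inr ⟨by omega, by linarith⟩)

/-- The left endpoint is excluded because it maps exactly onto the threshold with digit `m`, where
the bound `-(β + 1)` on the conjugate is too weak. -/
theorem InDomain.step {β : ℝ} {m : ℤ} (h : QuadraticData β m) {y y' : ℝ}
    (hD : InDomain β m y y') (hy : y ≠ 1 / (β + 1) - 1) :
    InDomain β m (T β y) (conjStep β m y y') := by
  have h1 := h.one_lt
  have hlt := h.lt_self
  obtain ⟨hd0, hle, hcases⟩ := hD.step_bounds h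
  have hd0' : (0 : ℝ) ≤ ⌊-β * y + β / (β + 1)⌋ := by exact_mod_cast hd0
  refine ⟨T_mem_I h1 y, by linarith, fun hz => ?_, fun hz => ?_⟩
  · rcases hcases with ⟨-, -, -, hb⟩ | ⟨-, -, hb⟩ | ⟨hd, hb⟩
    · exact hb
    · linarith
    · have : (⌊-β * y + β / (β + 1)⌋ : ℝ) ≤ m - 1 := by exact_mod_cast hd
      linarith
  · rcases hcases with ⟨-, hb, hb', -⟩ | ⟨-, -, hb⟩ | ⟨hd, hb⟩
    · exact absurd (hb' (le_antisymm hb hz)) hy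
    · exact hb
    · have : (⌊-β * y + β / (β + 1)⌋ : ℝ) ≤ m - 1 := by exact_mod_cast hd
      linarith

/-- The natural extension of `T` is injective on its domain. -/
theorem InDomain.step_injective {β : ℝ} {m : ℤ} (h : QuadraticData β m) {x x' y y' : ℝ}
    (hx : InDomain β m x x') (hy : InDomain β m y y') (hT : T β x = T β y)
    (hc : conjStep β m x x' = conjStep β m y y') : x = y := by
  have h1 := h.one_lt
  have hlt' := h.self_lt
  suffices hd : ⌊-β * x + β / (β + 1)⌋ = ⌊-β * y + β / (β + 1)⌋ by
    unfold T at hT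
    rw [hd] at hT
    have : β * (x - y) = 0 := by linarith
    rcases mul_eq_zero.1 this with h0 | h0 <;> linarith
  obtain ⟨-, hxle, hxc⟩ := hx.step_bounds h
  obtain ⟨-, hyle, hyc⟩ := hy.step_bounds h
  rw [hT, hc] at hxc
  rw [hc] at hxle
  generalize ⌊-β * x + β / (β + 1)⌋ = d at *
  generalize ⌊-β * y + β / (β + 1)⌋ = e at *
  -- The image determines the digit: the first two cases lie on opposite sides of the threshold, and
  -- in every pair involving the third the bounds on the conjugate leave one digit or none.
  rcases hxc with ⟨hd, hb, -, hb'⟩ | ⟨hd, hb, hb'⟩ | ⟨hd, hb⟩ <;>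
  rcases hyc with ⟨he, hb1, -, hb1'⟩ | ⟨he, hb1, hb1'⟩ | ⟨he, hb1⟩
  · omega
  · linarith
  · have : (d : ℝ) < e + 1 := by linarith
    have : d < e + 1 := by exact_mod_cast this
    omega
  · linarith
  · omega
  · have : (d : ℝ) < e + 1 := by linarith
    have : d < e + 1 := by exact_mod_cast this
    omega
  · have : (e : ℝ) < d + 1 := by linarith
    have : e < d + 1 := by exact_mod_cast this
    omega
  · have : (e : ℝ) < d + 1 := by linarith
    have : e < d + 1 := by exact_mod_cast this
    omega
  · have h2 : (e : ℝ) < d + 1 := by linarith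
    have h3 : (d : ℝ) < e + 1 := by linarith
    have h2' : e < d + 1 := by exact_mod_cast h2
    have h3' : d < e + 1 := by exact_mod_cast h3
    omega

/-! ### Dynamics on `(1/q)ℤ[β]` and rational points -/

/-- The element `(a + bβ)/q` of `ℚ(β)`. -/
noncomputable def latticePoint (β : ℝ) (q : ℤ) (s : ℤ × ℤ) : ℝ := (s.1 + s.2 * β) / q

/-- The conjugate of `(a + bβ)/q`. -/
noncomputable def latticeConj (β : ℝ) (m q : ℤ) (s : ℤ × ℤ) : ℝ := (s.1 + s.2 * (m - β)) / q

/-- The transformation `T` on the coordinates of `(a + bβ)/q`. -/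
noncomputable def latticeStep (β : ℝ) (m q : ℤ) (s : ℤ × ℤ) : ℤ × ℤ :=
  (-s.2 - q * ⌊-β * latticePoint β q s + β / (β + 1)⌋, -s.1 - m * s.2)

namespace QuadraticData

variable {β : ℝ} {m q : ℤ}

theorem latticePoint_step (h : QuadraticData β m) (hq : 0 < q) (s : ℤ × ℤ) :
    latticePoint β q (latticeStep β m q s) = T β (latticePoint β q s) := by
  have hq' : (q : ℝ) ≠ 0 := by exact_mod_cast hq.ne'
  rw [T, latticeStep]
  generalize ⌊-β * latticePoint β q s + β / (β + 1)⌋ = d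
  unfold latticePoint
  push_cast
  field_simp
  linear_combination (s.2 : ℝ) * h.sq_eq

theorem latticeConj_step (h : QuadraticData β m) (hq : 0 < q) (s : ℤ × ℤ) :
    latticeConj β m q (latticeStep β m q s) =
      conjStep β m (latticePoint β q s) (latticeConj β m q s) := by
  have hq' : (q : ℝ) ≠ 0 := by exact_mod_cast hq.ne'
  rw [conjStep, latticeStep]
  generalize ⌊-β * latticePoint β q s + β / (β + 1)⌋ = d
  unfold latticeConj
  push_cast
  field_simp
  linear_combination (s.2 : ℝ) * h.sq_eq

theorem latticePoint_iterate (h : QuadraticData β m) (hq : 0 < q) (s : ℤ × ℤ) (n : ℕ) :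
    latticePoint β q ((latticeStep β m q)^[n] s) = (T β)^[n] (latticePoint β q s) := by
  induction n with
  | zero => rfl
  | succ n ih =>
    rw [Function.iterate_succ_apply', Function.iterate_succ_apply', h.latticePoint_step hq, ih]

theorem latticePoint_injective (h : QuadraticData β m) (hq : 0 < q) :
    Function.Injective (latticePoint β q) := by
  intro s t hst
  have hq' : (q : ℝ) ≠ 0 := by exact_mod_cast hq.ne'
  unfold latticePoint at hst
  rw [div_left_inj' hq'] at hst
  exact Prod.ext_iff.2 (h.eq_of_add_mul_eq hst)

/-- The conjugate of `-β/(β+1)` is `-β'/(β'+1)`, positive since `-1 < β' < 0`. This discharges the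
exclusion in `InDomain.step`. -/
theorem latticePoint_ne_left (h : QuadraticData β m) (hq : 0 < q) {s : ℤ × ℤ}
    (hs : latticeConj β m q s ≤ 0) : latticePoint β q s ≠ 1 / (β + 1) - 1 := by
  intro he
  have h1 := h.one_lt
  have hlt := h.lt_self
  have hqR : (0 : ℝ) < q := by exact_mod_cast hq
  have he' : ((s.1 : ℝ) + s.2 * β) * (β + 1) = -(q * β) := by
    unfold latticePoint at he
    field_simp at he
    linarith
  have hz : ((s.1 + s.2 : ℤ) : ℝ) + ((s.1 + s.2 + s.2 * m + q : ℤ) : ℝ) * β = 0 := by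
    push_cast
    linear_combination he' - (s.2 : ℝ) * h.sq_eq
  obtain ⟨e1, e2⟩ := h.eq_zero_of_add_mul_eq_zero hz
  have hs' : (s.1 : ℝ) + s.2 * (m - β) ≤ 0 := by
    unfold latticeConj at hs
    rwa [div_le_iff₀ hqR, zero_mul] at hs
  have hs2 : s.2 * m = -q := by linarith
  have hneg : s.2 < 0 := by
    by_contra hc
    have := h.one_le
    nlinarith
  have hnegR : (s.2 : ℝ) < 0 := by exact_mod_cast hneg
  have e1R : (s.1 : ℝ) = -s.2 := by
    have : s.1 = -s.2 := by linarith
    exact_mod_cast this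
  rw [e1R] at hs'
  nlinarith

theorem finite_inDomain (h : QuadraticData β m) (hq : 0 < q) :
    {s : ℤ × ℤ | InDomain β m (latticePoint β q s) (latticeConj β m q s)}.Finite := by
  have h1 := h.one_lt
  have hlt := h.lt_self
  have hqR : (0 : ℝ) < q := by exact_mod_cast hq
  have hm : (1 : ℝ) ≤ m := by exact_mod_cast h.one_le
  -- Subtracting conjugates gives `b (2β - m) = q (y - y')`, with `2β - m > 1` and `|y - y'| < β +
  -- 2`, so `K` bounds `b`; then `L` bounds `a`.
  obtain ⟨K, hK⟩ := exists_nat_gt (q * (β + 2))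
  obtain ⟨L, hL⟩ := exists_nat_gt (K + K * β)
  refine ((Set.finite_Icc (-(L : ℤ)) L).prod (Set.finite_Icc (-(K : ℤ)) K)).subset ?_
  intro s hs
  have hmem := (mem_I_iff h1).1 hs.mem
  have hw0 : 0 < 1 / (β + 1) := by positivity
  have hw1 : 1 / (β + 1) < 1 := by rw [div_lt_one (by linarith)]; linarith
  have hy : |latticePoint β q s| < 1 := by rw [abs_lt]; constructor <;> linarith
  have hy' : |latticeConj β m q s| < β + 1 := by
    have hlow : -(β + 1) < latticeConj β m q s := by
      rcases lt_or_ge (latticePoint β q s) (1 / (β + 1) - 1 - m + β) with hc | hc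
      · exact hs.left hc
      · linarith [hs.right hc]
    rw [abs_lt]; constructor <;> linarith [hs.nonpos]
  unfold latticePoint at hy
  unfold latticeConj at hy'
  rw [abs_div, abs_of_pos hqR, div_lt_iff₀ hqR, abs_lt] at hy hy'
  have hb : |(s.2 : ℝ)| ≤ K := by
    rw [abs_le]
    constructor
    · by_contra hc
      nlinarith
    · by_contra hc
      nlinarith
  have hbβ : |(s.2 : ℝ) * β| ≤ K * β := by
    rw [abs_mul, abs_of_pos (by linarith : 0 < β)]
    exact mul_le_mul_of_nonneg_right hb (by linarith)
  have hqK : (q : ℝ) < K := by nlinarith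
  rw [abs_le] at hb hbβ
  have ha : -(L : ℝ) ≤ s.1 ∧ (s.1 : ℝ) ≤ L := by constructor <;> linarith
  refine Set.mem_prod.2 ⟨⟨?_, ?_⟩, ?_, ?_⟩
  · exact_mod_cast ha.1
  · exact_mod_cast ha.2
  · exact_mod_cast hb.1
  · exact_mod_cast hb.2

/-- An injective self-map of a finite set has only periodic points. -/
theorem exists_iterate_eq_of_inDomain (h : QuadraticData β m) (hq : 0 < q) {s : ℤ × ℤ}
    (hs : InDomain β m (latticePoint β q s) (latticeConj β m q s)) :
    ∃ N, 0 < N ∧ (T β)^[N] (latticePoint β q s) = latticePoint β q s := by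
  set S := {s : ℤ × ℤ | InDomain β m (latticePoint β q s) (latticeConj β m q s)}
  have hmaps : Set.MapsTo (latticeStep β m q) S S := by
    intro t (ht : InDomain β m _ _)
    change InDomain β m _ _
    rw [h.latticePoint_step hq, h.latticeConj_step hq]
    exact ht.step h (h.latticePoint_ne_left hq ht.nonpos)
  have hinj : Function.Injective (hmaps.restrict (latticeStep β m q) S S) := by
    rw [Set.MapsTo.restrict_inj]
    intro t (ht : InDomain β m _ _) u (hu : InDomain β m _ _) htu
    refine h.latticePoint_injective hq (ht.step_injective h hu ?_ ?_)
    · rw [← h.latticePoint_step hq, ← h.latticePoint_step hq, htu]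
    · rw [← h.latticeConj_step hq, ← h.latticeConj_step hq, htu]
  have : Finite S := h.finite_inDomain hq
  obtain ⟨N, hN, hper⟩ := hinj.mem_periodicPts (⟨s, hs⟩ : S)
  refine ⟨N, hN, ?_⟩
  have := congrArg Subtype.val (show _ = _ from hper)
  rw [hmaps.iterate_restrict, Set.MapsTo.val_restrict_apply] at this
  rw [← h.latticePoint_iterate hq, this]

theorem latticePoint_rat (x : ℚ) : latticePoint β x.den (x.num, 0) = x := by
  simp [latticePoint, Rat.cast_def]

theorem latticeConj_rat (x : ℚ) : latticeConj β m x.den (x.num, 0) = x := by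
  simp [latticeConj, Rat.cast_def]

theorem hasPurelyPeriodicExpansion_of_nonpos (h : QuadraticData β m) (x : ℚ)
    (hx : (x : ℝ) ∈ I β) (hx0 : x ≤ 0) : HasPurelyPeriodicExpansion β (x : ℝ) := by
  have h1 := h.one_lt
  have hx0' : (x : ℝ) ≤ 0 := by exact_mod_cast hx0
  have hw0 : 0 < 1 / (β + 1) := by positivity
  have hl := ((mem_I_iff h1).1 hx).1
  have hq : 0 < (x.den : ℤ) := by exact_mod_cast x.den_pos
  have hD : InDomain β m (x : ℝ) (x : ℝ) :=
    ⟨hx, hx0', fun _ => by linarith, fun _ => by linarith⟩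
  obtain ⟨N, hN, hper⟩ := h.exists_iterate_eq_of_inDomain hq (s := (x.num, 0))
    (by rwa [latticePoint_rat, latticeConj_rat])
  rw [latticePoint_rat] at hper
  exact hasPurelyPeriodicExpansion_of_iterate_eq hN hper

/-- Each step contracts the conjugate by `β - m` and subtracts a nonnegative digit. -/
theorem latticeConj_iterate_le (h : QuadraticData β m) (hq : 0 < q) {s : ℤ × ℤ}
    (hs : latticePoint β q s ∈ I β) (n : ℕ) :
    latticeConj β m q ((latticeStep β m q)^[n] s) ≤ latticeConj β m q s * (β - m) ^ n := by
  have h1 := h.one_lt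
  have hlt := h.lt_self
  induction n with
  | zero => simp
  | succ n ih =>
    rw [Function.iterate_succ_apply', h.latticeConj_step hq, conjStep, h.latticePoint_iterate hq,
      pow_succ]
    have hd : (0 : ℝ) ≤ ⌊-β * (T β)^[n] (latticePoint β q s) + β / (β + 1)⌋ := by
      exact_mod_cast digits_nonneg h1 hs n
    have := mul_le_mul_of_nonneg_right ih (by linarith : 0 ≤ β - m)
    linarith

theorem not_hasPurelyPeriodicExpansion_of_pos (h : QuadraticData β m) (x : ℚ)
    (hx : (x : ℝ) ∈ I β) (hx0 : 0 < x) : ¬ HasPurelyPeriodicExpansion β (x : ℝ) := by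
  intro hp
  have hlt := h.lt_self
  have hlt' := h.self_lt
  have hx0' : (0 : ℝ) < x := by exact_mod_cast hx0
  have hq : 0 < (x.den : ℤ) := by exact_mod_cast x.den_pos
  obtain ⟨N, hN, hper⟩ := exists_iterate_eq_of_hasPurelyPeriodicExpansion h.one_lt hx hp
  have hstep : (latticeStep β m x.den)^[N] (x.num, 0) = (x.num, 0) :=
    h.latticePoint_injective hq (by rw [h.latticePoint_iterate hq, latticePoint_rat, hper])
  have hle := h.latticeConj_iterate_le hq (s := (x.num, 0)) (by rwa [latticePoint_rat]) N
  rw [hstep, latticeConj_rat] at hle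
  have : (β - m) ^ N < 1 := pow_lt_one₀ (by linarith) (by linarith) hN.ne'
  nlinarith

end QuadraticData

/-! ### Failure of finiteness -/

/-- The pairs consisting of an element of `ℤ[β]` and its conjugate, where `β² = mβ + 1`. -/
def conjPairs (β : ℝ) (m : ℤ) : Set (ℝ × ℝ) :=
  {z | ∃ a b : ℤ, z.1 = a + b * β ∧ z.2 = a + b * (m - β)}

namespace QuadraticData

variable {β : ℝ} {m : ℤ}

theorem conjPairs_unique (h : QuadraticData β m) {x y z : ℝ} (hy : (x, y) ∈ conjPairs β m)
    (hz : (x, z) ∈ conjPairs β m) : y = z := by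
  obtain ⟨a, b, h1, h2⟩ := hy
  obtain ⟨c, d, h3, h4⟩ := hz
  simp only at h1 h2 h3 h4
  obtain ⟨rfl, rfl⟩ := h.eq_of_add_mul_eq (h1.symm.trans h3)
  rw [h2, h4]

/-- The pairs of conjugate elements as a subring of `ℝ × ℝ`. -/
def conjSubring (h : QuadraticData β m) : Subring (ℝ × ℝ) where
  carrier := conjPairs β m
  mul_mem' := by
    rintro ⟨x, x'⟩ ⟨y, y'⟩ ⟨a, b, h1, h2⟩ ⟨c, d, h3, h4⟩
    simp only at h1 h2 h3 h4
    refine ⟨a * c + b * d, a * d + b * c + m * b * d, ?_, ?_⟩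
    · simp only [Prod.mk_mul_mk, h1, h3]; push_cast
      linear_combination (b * d : ℝ) * h.sq_eq
    · simp only [Prod.mk_mul_mk, h2, h4]; push_cast
      linear_combination (b * d : ℝ) * h.sq_eq
  one_mem' := ⟨1, 0, by simp, by simp⟩
  add_mem' := by
    rintro ⟨x, x'⟩ ⟨y, y'⟩ ⟨a, b, h1, h2⟩ ⟨c, d, h3, h4⟩
    simp only at h1 h2 h3 h4
    refine ⟨a + c, b + d, ?_, ?_⟩
    · simp only [Prod.mk_add_mk, h1, h3]; push_cast; ring
    · simp only [Prod.mk_add_mk, h2, h4]; push_cast; ring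
  zero_mem' := ⟨0, 0, by simp, by simp⟩
  neg_mem' := by
    rintro ⟨x, x'⟩ ⟨a, b, h1, h2⟩
    simp only at h1 h2
    refine ⟨-a, -b, ?_, ?_⟩
    · simp only [Prod.neg_mk, h1]; push_cast; ring
    · simp only [Prod.neg_mk, h2]; push_cast; ring

theorem inv_eq (h : QuadraticData β m) : β⁻¹ = β - m := by
  refine (eq_inv_of_mul_eq_one_left ?_).symm
  linear_combination h.sq_eq

/-- Negative exponents are allowed because `β` is a unit: `β⁻¹ = β - m`. -/
theorem zpow_mem_conjSubring (h : QuadraticData β m) (k : ℤ) :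
    (((-β) ^ k, (β - m) ^ k) : ℝ × ℝ) ∈ h.conjSubring := by
  have hinv : (β - m)⁻¹ = β := by rw [← h.inv_eq, inv_inv]
  have h1 : ((-β, β - m) : ℝ × ℝ) ∈ h.conjSubring := ⟨0, -1, by simp, by simp⟩
  have h2 : (((-β)⁻¹, (β - m)⁻¹) : ℝ × ℝ) ∈ h.conjSubring :=
    ⟨m, -1, by rw [inv_neg, h.inv_eq]; push_cast; ring, by rw [hinv]; push_cast; ring⟩
  cases k with
  | ofNat n => simpa using pow_mem h1 n
  | negSucc n => simpa only [zpow_negSucc, inv_pow, Prod.pow_mk] using pow_mem h2 (n + 1)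

theorem neg_one_notMem_finiteExpansions (h : QuadraticData β m) : -1 ∉ finiteExpansions β := by
  have hlt := h.lt_self
  rintro (h0 | ⟨n, s, ⟨-, ⟨y, hy, hs⟩, hsum⟩, k, hk⟩)
  · norm_num at h0
  have hs0 : ∀ i, 0 ≤ s i := fun i => by
    have := digits_nonneg h.one_lt hy (i + 1)
    rwa [hs] at this
  have hfin : ∑ i ∈ Finset.range k, (s i : ℝ) * (-β) ^ (n - (i : ℤ)) = -1 := by
    refine (hasSum_sum_of_ne_finset_zero fun i hi => ?_).unique hsum
    rw [hk i (by simpa using hi)]; simp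
  -- Conjugating the finite sum termwise gives a sum of nonnegative terms, which would have to equal
  -- the conjugate `-1` of `-1`.
  have hmem : ((∑ i ∈ Finset.range k, (s i : ℝ) * (-β) ^ (n - (i : ℤ)),
      ∑ i ∈ Finset.range k, (s i : ℝ) * (β - m) ^ (n - (i : ℤ))) : ℝ × ℝ) ∈ h.conjSubring := by
    have : ∑ i ∈ Finset.range k, ((s i : ℤ) : ℝ × ℝ) *
        ((-β) ^ (n - (i : ℤ)), (β - m) ^ (n - (i : ℤ))) ∈ h.conjSubring :=
      sum_mem fun i _ => mul_mem (intCast_mem _ _) (h.zpow_mem_conjSubring _)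
    convert this using 1
    ext <;> simp [Prod.fst_sum, Prod.snd_sum]
  rw [hfin] at hmem
  have hneg : ((-1, -1) : ℝ × ℝ) ∈ h.conjSubring := neg_mem (one_mem h.conjSubring)
  have heq := h.conjPairs_unique hmem hneg
  have hnonneg : 0 ≤ ∑ i ∈ Finset.range k, (s i : ℝ) * (β - m) ^ (n - (i : ℤ)) :=
    Finset.sum_nonneg fun i _ =>
      mul_nonneg (by exact_mod_cast hs0 i) (zpow_nonneg (by linarith) _)
  linarith

end QuadraticData

end NegBase

theorem theorem7 (β : ℝ) (hβ : NegBase.IsQuadraticPisotUnit β)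
    (hneg : NegBase.HasNegativeConjugate β) :
    (∀ x : ℚ, (x : ℝ) ∈ NegBase.I β → x ≤ 0 → NegBase.HasPurelyPeriodicExpansion β (x : ℝ)) ∧
    (∀ x : ℚ, (x : ℝ) ∈ NegBase.I β → 0 < x → ¬ NegBase.HasPurelyPeriodicExpansion β (x : ℝ)) ∧
    ¬ NegBase.FinitenessProperty β := by
  obtain ⟨m, h⟩ := NegBase.exists_quadraticData hβ hneg
  refine ⟨h.hasPurelyPeriodicExpansion_of_nonpos, h.not_hasPurelyPeriodicExpansion_of_pos, ?_⟩
  intro hF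
  refine h.neg_one_notMem_finiteExpansions ?_
  rw [hF]
  exact neg_mem (one_mem (Algebra.adjoin ℤ {β}))
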